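/- Let $\phi : \mathbb{R}^n \to [0,\infty)$ be convex and positively $1$-homogeneous (that is, $\phi(\alpha y) = \alpha\,\phi(y)$ for all $\alpha > 0$ and $y \in \mathbb{R}^n$), with $\phi(y) = 0$ if and only if $y = 0$; $\phi$ need not be even. Let $$W_\phi = \{ x \in \mathbb{R}^n \mid -x \cdot y \le \phi(y) \text{ for all } y \in \mathbb{R}^n \}$$ be its Wulff shape. For $u \in BV(\mathbb{R}^n)$, with distributional gradient the $\mathbb{R}^n$-valued Radon measure $Du$, let $$TV_\phi(u) = \int_{\mathbb{R}^n} \phi(\mathrm{d}Du) = \sup\left\{ \int_{\mathbb{R}^n} \varphi \cdot \mathrm{d}Du \;\middle|\; \varphi \in C^1_c(\mathbb{R}^n;\mathbb{R}^n),\ \varphi(x) \in -W_\phi \text{ for all } x \in \mathbb{R}^n \right\},$$ and write $TV_\phi(\Omega) = TV_\phi(\chi_\Omega)$ for the anisotropic perimeter of a set $\Omega \subset \mathbb{R}^n$ with $\chi_\Omega \in BV(\mathbb{R}^n)$. Then $\chi_{W_\phi} \in BV(\mathbb{R}^n)$ and $$TV_\phi(W_\phi) = n\,|W_\phi|,$$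 where $|W_\phi|$ is the Lebesgue measure of $W_\phi$. -/

import Mathlib

open MeasureTheory Set
open scoped ENNReal

noncomputable section

/-- An anisotropy (gauge) on `ℝⁿ`: a convex, nonnegative, positively `1`-homogeneous function
that vanishes exactly at the origin. It need not be even. -/
structure IsAnisotropy {n : ℕ} (φ : EuclideanSpace ℝ (Fin n) → ℝ) : Prop where
  convexOn : ConvexOn ℝ univ φ
  nonneg : ∀ y, 0 ≤ φ y
  pos_homogeneous : ∀ (a : ℝ) (y : EuclideanSpace ℝ (Fin n)), 0 < a → φ (a • y) = a * φ y
  eq_zero_iff : ∀ y, φ y = 0 ↔ y = 0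

/-- The Wulff shape `W_φ = {x | -x ⬝ y ≤ φ y for all y}`. -/
def wulffShape {n : ℕ} (φ : EuclideanSpace ℝ (Fin n) → ℝ) : Set (EuclideanSpace ℝ (Fin n)) :=
  {x | ∀ y, -(inner ℝ x y) ≤ φ y}

/-- The integral `∫ ψ ⬝ dμ = ∑ i, ∫ ψ_i dμ_i` of a vector field against an `ℝⁿ`-valued (finite)
Radon measure on `ℝⁿ`, given by its `n` components. -/
def integralAgainst {n : ℕ} (μ : Fin n → SignedMeasure (EuclideanSpace ℝ (Fin n)))
    (ψ : EuclideanSpace ℝ (Fin n) → EuclideanSpace ℝ (Fin n)) : ℝ :=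
  ∑ i, ∫ᵛ x, ψ x i ∂•(μ i)

/-- The anisotropic total variation `∫ φ(dμ)` of an `ℝⁿ`-valued Radon measure `μ`: the supremum,
in the extended reals, of `∫ ψ ⬝ dμ` over all `C¹` vector fields `ψ` with compact support and
values in `-W_φ`. -/
def anisoVariation {n : ℕ} (φ : EuclideanSpace ℝ (Fin n) → ℝ)
    (μ : Fin n → SignedMeasure (EuclideanSpace ℝ (Fin n))) : EReal :=
  sSup {r : EReal | ∃ ψ : EuclideanSpace ℝ (Fin n) → EuclideanSpace ℝ (Fin n),
    ContDiff ℝ 1 ψ ∧ HasCompactSupport ψ ∧ (∀ x, -(ψ x) ∈ wulffShape φ) ∧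
      r = (integralAgainst μ ψ : EReal)}

/-- `μ` is the distributional gradient of `u`: for every `f ∈ C¹_c(ℝⁿ)` and every `i`,
`∫ u ∂_i f = -∫ f dμ_i`. -/
def IsDistribGradient {n : ℕ} (u : EuclideanSpace ℝ (Fin n) → ℝ)
    (μ : Fin n → SignedMeasure (EuclideanSpace ℝ (Fin n))) : Prop :=
  ∀ f : EuclideanSpace ℝ (Fin n) → ℝ, ContDiff ℝ 1 f → HasCompactSupport f → ∀ i,
    ∫ x, u x * fderiv ℝ f x (EuclideanSpace.single i 1) = -∫ᵛ x, f x ∂•(μ i)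

/-- `u ∈ BV(ℝⁿ)`: `u` is integrable and its distributional gradient is an `ℝⁿ`-valued finite
Radon measure. -/
def MemBV {n : ℕ} (u : EuclideanSpace ℝ (Fin n) → ℝ) : Prop :=
  Integrable u ∧ ∃ μ : Fin n → SignedMeasure (EuclideanSpace ℝ (Fin n)), IsDistribGradient u μ

open Classical in
/-- The anisotropic total variation `TV_φ(u) = ∫ φ(dDu)` of `u ∈ BV(ℝⁿ)`, where `Du` is the
distributional gradient of `u`; it is `∞` outside `BV(ℝⁿ)`. -/
def anisoTV {n : ℕ} (φ : EuclideanSpace ℝ (Fin n) → ℝ) (u : EuclideanSpace ℝ (Fin n) → ℝ) :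
    EReal :=
  if h : MemBV u then anisoVariation φ h.2.choose else ⊤

/-- The coordinates of a compactly supported `C¹` field are compactly supported `C¹` functions. -/
theorem coord_contDiff_hasCompactSupport {n : ℕ}
    {ψ : EuclideanSpace ℝ (Fin n) → EuclideanSpace ℝ (Fin n)}
    (h1 : ContDiff ℝ 1 ψ) (h2 : HasCompactSupport ψ) (i : Fin n) :
    ContDiff ℝ 1 (fun x => ψ x i) ∧ HasCompactSupport (fun x => ψ x i) :=
  ⟨contDiff_euclidean.1 h1 i,
    h2.comp_left (g := fun y : EuclideanSpace ℝ (Fin n) => y i) (by simp)⟩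

/-- `anisoTV` does not depend on the choice of the measure that represents the gradient. -/
theorem anisoTV_eq {n : ℕ} (φ : EuclideanSpace ℝ (Fin n) → ℝ) {u : EuclideanSpace ℝ (Fin n) → ℝ}
    (hu : Integrable u) {μ : Fin n → SignedMeasure (EuclideanSpace ℝ (Fin n))}
    (hμ : IsDistribGradient u μ) : anisoTV φ u = anisoVariation φ μ := by
  have h : MemBV u := ⟨hu, μ, hμ⟩
  have key : ∀ ψ : EuclideanSpace ℝ (Fin n) → EuclideanSpace ℝ (Fin n), ContDiff ℝ 1 ψ →
      HasCompactSupport ψ → integralAgainst h.2.choose ψ = integralAgainst μ ψ := by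
    intro ψ h1 h2
    refine Finset.sum_congr rfl fun i _ => ?_
    obtain ⟨h3, h4⟩ := coord_contDiff_hasCompactSupport h1 h2 i
    exact neg_injective ((h.2.choose_spec _ h3 h4 i).symm.trans (hμ _ h3 h4 i))
  rw [anisoTV, dif_pos h, anisoVariation, anisoVariation]
  congr 1
  ext r
  constructor
  · rintro ⟨ψ, h1, h2, h3, rfl⟩
    exact ⟨ψ, h1, h2, h3, by rw [key ψ h1 h2]⟩
  · rintro ⟨ψ, h1, h2, h3, rfl⟩
    exact ⟨ψ, h1, h2, h3, by rw [key ψ h1 h2]⟩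

/-- The anisotropic perimeter `TV_φ(Ω) = TV_φ(χ_Ω)` of a set. -/
def anisoPerimeter {n : ℕ} (φ : EuclideanSpace ℝ (Fin n) → ℝ)
    (Ω : Set (EuclideanSpace ℝ (Fin n))) : EReal :=
  anisoTV φ (Ω.indicator fun _ => (1 : ℝ))

end

/-! Write W for the Wulff shape, a compact convex neighbourhood of 0. For a test field ψ = -ζ with ζ
valued in W, the pairing with the gradient of χ_W is ∫_W div ζ, so the claim is that these integrals
have supremum n|W|. Upper bound (`setIntegral_trace_fderiv_le`): by convexity x + tζ(x) maps W into
(1+t)W, injectively for small t > 0. The area formula gives ∫_W det(1 + t Dζ) ≤ (1+t)^n |W|, with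
equality at t = 0; comparing right derivatives there gives ∫_W div ζ ≤ n|W|. Lower bound
(`exists_field_trace_fderiv_eq`): for a < 1 a cutoff of ax is admissible and has divergence an on W;
let a → 1. χ_W is in BV (`exists_signedMeasure_setIntegral_fderiv`) because each line meets W in a
segment: a directional derivative integrates to exit values minus entry values. No regularity of the
boundary is used. -/

namespace IsAnisotropy

variable {n : ℕ} {φ : EuclideanSpace ℝ (Fin n) → ℝ}

theorem continuous (hφ : IsAnisotropy φ) : Continuous φ :=
  continuousOn_univ.1 (hφ.convexOn.continuousOn isOpen_univ)

theorem map_smul (hφ : IsAnisotropy φ) {a : ℝ} (ha : 0 ≤ a) (y : EuclideanSpace ℝ (Fin n)) :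
    φ (a • y) = a * φ y := by
  rcases ha.eq_or_lt with rfl | ha
  · simp [(hφ.eq_zero_iff 0).2 rfl]
  · exact hφ.pos_homogeneous a y ha

theorem map_eq_norm_mul (hφ : IsAnisotropy φ) (y : EuclideanSpace ℝ (Fin n)) :
    φ y = ‖y‖ * φ (‖y‖⁻¹ • y) := by
  rcases eq_or_ne y 0 with rfl | hy
  · simp [(hφ.eq_zero_iff 0).2 rfl]
  · rw [← hφ.map_smul (norm_nonneg y), smul_inv_smul₀ (norm_ne_zero_iff.2 hy)]

theorem exists_pos_mul_norm_le (hφ : IsAnisotropy φ) : ∃ c, 0 < c ∧ ∀ y, c * ‖y‖ ≤ φ y := by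
  obtain ⟨c, hc, h⟩ := (isCompact_sphere (0 : EuclideanSpace ℝ (Fin n)) 1).exists_forall_le'
    (a := 0) hφ.continuous.continuousOn fun y hy => (hφ.nonneg y).lt_of_ne' fun h0 => by
      simp [(hφ.eq_zero_iff y).1 h0] at hy
  refine ⟨c, hc, fun y => ?_⟩
  rcases eq_or_ne y 0 with rfl | hy
  · simp [(hφ.eq_zero_iff 0).2 rfl]
  · rw [hφ.map_eq_norm_mul y, mul_comm]
    refine mul_le_mul_of_nonneg_left (h _ ?_) (norm_nonneg y)
    simp [norm_smul, hy]

theorem exists_le_mul_norm (hφ : IsAnisotropy φ) : ∃ C, ∀ y, φ y ≤ C * ‖y‖ := by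
  obtain ⟨C, h⟩ := (isCompact_sphere (0 : EuclideanSpace ℝ (Fin n)) 1).bddAbove_image
    hφ.continuous.continuousOn
  refine ⟨C, fun y => ?_⟩
  rcases eq_or_ne y 0 with rfl | hy
  · simp [(hφ.eq_zero_iff 0).2 rfl]
  · rw [hφ.map_eq_norm_mul y, mul_comm]
    refine mul_le_mul_of_nonneg_right (h ⟨_, ?_, rfl⟩) (norm_nonneg y)
    simp [norm_smul, hy]

end IsAnisotropy

/-! ### The Wulff shape is a compact convex neighbourhood of 0. -/

section WulffShape

variable {n : ℕ} {φ : EuclideanSpace ℝ (Fin n) → ℝ}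

theorem isClosed_wulffShape (φ : EuclideanSpace ℝ (Fin n) → ℝ) : IsClosed (wulffShape φ) := by
  simp only [wulffShape, ofPred_forall]
  exact isClosed_iInter fun y => isClosed_le (by fun_prop) continuous_const

theorem convex_wulffShape (φ : EuclideanSpace ℝ (Fin n) → ℝ) : Convex ℝ (wulffShape φ) := by
  intro x hx z hz a b ha hb hab y
  have h1 := mul_le_mul_of_nonneg_left (hx y) ha
  have h2 := mul_le_mul_of_nonneg_left (hz y) hb
  have h3 : a * φ y + b * φ y = φ y := by rw [← add_mul, hab, one_mul]
  rw [inner_add_left, inner_smul_left, inner_smul_left]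
  simp only [conj_trivial]
  linarith

theorem IsAnisotropy.isCompact_wulffShape (hφ : IsAnisotropy φ) : IsCompact (wulffShape φ) := by
  obtain ⟨C, hC⟩ := hφ.exists_le_mul_norm
  refine Metric.isCompact_of_isClosed_isBounded (isClosed_wulffShape φ) ?_
  -- For n = 0 the unit sphere is empty and C may be negative, hence `max C 0`.
  refine (Metric.isBounded_closedBall (x := 0) (r := max C 0)).subset fun x hx => ?_
  rw [mem_closedBall_zero_iff]
  rcases eq_or_ne x 0 with rfl | h0
  · simp
  -- Testing with y = -x gives ‖x‖² ≤ C‖x‖.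
  · have h := (hx (-x)).trans (hC (-x))
    rw [inner_neg_right, neg_neg, real_inner_self_eq_norm_sq, norm_neg, sq] at h
    exact (le_of_mul_le_mul_right h (norm_pos_iff.2 h0)).trans (le_max_left _ _)

theorem IsAnisotropy.wulffShape_mem_nhds (hφ : IsAnisotropy φ) : wulffShape φ ∈ nhds 0 := by
  obtain ⟨c, hc, h⟩ := hφ.exists_pos_mul_norm_le
  refine Filter.mem_of_superset (Metric.closedBall_mem_nhds 0 hc) fun x hx y => ?_
  rw [mem_closedBall_zero_iff] at hx
  calc -(inner ℝ x y) ≤ ‖x‖ * ‖y‖ := (neg_le_abs _).trans (abs_real_inner_le_norm x y)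
    _ ≤ c * ‖y‖ := mul_le_mul_of_nonneg_right hx (norm_nonneg y)
    _ ≤ φ y := h y

end WulffShape

/-! ### The upper bound, by first variation of volume. -/

section Det

open scoped Pointwise

variable {E : Type*} [NormedAddCommGroup E] [NormedSpace ℝ E] [FiniteDimensional ℝ E]

theorem ContinuousLinearMap.contDiff_det {k : WithTop ℕ∞} :
    ContDiff ℝ k fun A : E →L[ℝ] E => A.det := by
  classical
  let b := Module.finBasis ℝ E
  have h (A : E →L[ℝ] E) : A.det = ∑ σ : Equiv.Perm (Fin (Module.finrank ℝ E)),
      ((Equiv.Perm.sign σ : ℤ) : ℝ) * ∏ i, LinearMap.toContinuousLinearMap (b.coord (σ i)) (A (b i)) := by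
    rw [ContinuousLinearMap.det, ← LinearMap.det_toMatrix b, Matrix.det_apply']
    simp [LinearMap.toMatrix_apply]
  simp only [h]
  refine ContDiff.sum fun σ _ => contDiff_const.mul (contDiff_prod fun i _ => ?_)
  exact (ContinuousLinearMap.contDiff _).comp (contDiff_id.clm_apply contDiff_const)

theorem LinearMap.hasDerivAt_det_one_add_smul (A : E →ₗ[ℝ] E) :
    HasDerivAt (fun t : ℝ => LinearMap.det (1 + t • A)) (LinearMap.trace ℝ E A) 0 := by
  classical
  let b := Module.finBasis ℝ E
  have h (t : ℝ) := show LinearMap.det (1 + t • A) = 1 + (LinearMap.toMatrix b b A).trace * t +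
      (1 + (Polynomial.X : Polynomial ℝ) •
        (LinearMap.toMatrix b b A).map Polynomial.C).det.divX.divX.eval t * t ^ 2 by
    rw [← LinearMap.det_toMatrix b, map_add, map_smul, LinearMap.toMatrix_one,
      Matrix.det_one_add_smul]
  simp only [h, ← LinearMap.trace_eq_matrix_trace ℝ b A]
  have h1 := ((hasDerivAt_id (0 : ℝ)).const_mul (LinearMap.trace ℝ E A)).const_add 1
  have h2 := (Polynomial.hasDerivAt ((1 + (Polynomial.X : Polynomial ℝ) •
    (LinearMap.toMatrix b b A).map Polynomial.C).det.divX.divX) 0).mul (hasDerivAt_pow 2 (0 : ℝ))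
  simpa [Pi.add_def] using h1.add h2

variable [MeasurableSpace E] [BorelSpace E] (μ : Measure E) [μ.IsAddHaarMeasure]

/-- Differentiation under the integral: `det` is Lipschitz near 1 and f is bounded on W, so the
difference quotients are dominated by a constant. -/
theorem tendsto_slope_setIntegral_det {W : Set E} (hW : IsCompact W) {f : E → E →L[ℝ] E}
    (hf : Continuous f) :
    Filter.Tendsto (fun t : ℝ => t⁻¹ * ((∫ x in W, (1 + t • f x).det ∂μ) - μ.real W))
      (nhdsWithin 0 (Ioi 0)) (nhds (∫ x in W, LinearMap.trace ℝ E (f x) ∂μ)) := by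
  obtain ⟨K, s, hs, hK⟩ := (ContinuousLinearMap.contDiff_det (E := E) (k := 1)).contDiffAt
    (x := 1) |>.exists_lipschitzOnWith
  obtain ⟨r, hr, hrs⟩ := Metric.mem_nhds_iff.1 hs
  obtain ⟨C, hC0, hC⟩ := (hW.image hf).isBounded.exists_pos_norm_le
  have hcont (t : ℝ) : Continuous fun x => (1 + t • f x).det :=
    ContinuousLinearMap.continuous_det.comp (by fun_prop)
  have hfin : IsFiniteMeasure (μ.restrict W) := ⟨by simpa using hW.measure_lt_top⟩
  have heq (t : ℝ) : t⁻¹ * ((∫ x in W, (1 + t • f x).det ∂μ) - μ.real W) =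
      ∫ x in W, t⁻¹ * ((1 + t • f x).det - 1) ∂μ := by
    rw [integral_const_mul, integral_sub ((hcont t).continuousOn.integrableOn_compact hW)
      (integrable_const _)]
    simp
  simp only [heq]
  refine tendsto_integral_filter_of_dominated_convergence (fun _ => K * C)
    (.of_forall fun t => ((hcont t).sub continuous_const |>.const_mul _).aestronglyMeasurable)
    ?_ (integrable_const _) (.of_forall fun x => ?_)
  · have hlt : ∀ᶠ t : ℝ in nhdsWithin (0 : ℝ) (Ioi 0), t * C < r := by
      refine nhdsWithin_le_nhds (Filter.Tendsto.eventually_lt_const hr ?_)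
      have : Continuous fun t : ℝ => t * C := by fun_prop
      simpa using this.tendsto 0
    filter_upwards [hlt, self_mem_nhdsWithin] with t ht ht0
    rw [mem_Ioi] at ht0
    refine (ae_restrict_mem hW.measurableSet).mono fun x hx => ?_
    have hn : ‖t • f x‖ ≤ t * C := by
      rw [norm_smul, Real.norm_of_nonneg ht0.le]
      exact mul_le_mul_of_nonneg_left (hC _ ⟨x, hx, rfl⟩) ht0.le
    have h1 := hK.norm_sub_le (x := 1 + t • f x) (y := 1)
      (hrs (by simpa [dist_eq_norm] using hn.trans_lt ht)) (mem_of_mem_nhds hs)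
    have h2 : (1 : E →L[ℝ] E).det = 1 := by
      simp [ContinuousLinearMap.det]
    rw [h2, add_sub_cancel_left] at h1
    rw [norm_mul, norm_inv, Real.norm_of_nonneg ht0.le, inv_mul_le_iff₀ ht0]
    calc _ ≤ K * ‖t • f x‖ := h1
      _ ≤ K * (t * C) := mul_le_mul_of_nonneg_left hn K.2
      _ = _ := by ring
  · have h := (hasDerivAt_iff_tendsto_slope.1
      (LinearMap.hasDerivAt_det_one_add_smul (f x : E →ₗ[ℝ] E))).mono_left
      (nhdsWithin_mono 0 (fun t (ht : 0 < t) => ht.ne'))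
    refine h.congr fun t => ?_
    simp [slope_def_field, ContinuousLinearMap.det, div_eq_inv_mul]

theorem setIntegral_trace_fderiv_le {W : Set E} (hW : IsCompact W) (hconv : Convex ℝ W)
    {f : E → E} (hf : ContDiff ℝ 1 f) (hsupp : HasCompactSupport f) (hfW : ∀ x, f x ∈ W) :
    ∫ x in W, LinearMap.trace ℝ E (fderiv ℝ f x) ∂μ ≤ Module.finrank ℝ E * μ.real W := by
  set d := Module.finrank ℝ E
  obtain ⟨K, hK⟩ := hf.lipschitzWith_of_hasCompactSupport hsupp one_ne_zero
  have hpow : Filter.Tendsto (fun t : ℝ => t⁻¹ * ((1 + t) ^ d * μ.real W - μ.real W))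
      (nhdsWithin 0 (Ioi 0)) (nhds (d * μ.real W)) := by
    have h : HasDerivAt (fun t : ℝ => (1 + t) ^ d * μ.real W) (d * μ.real W) 0 := by
      simpa using (((hasDerivAt_id (0 : ℝ)).const_add 1).pow d).mul_const (μ.real W)
    refine ((hasDerivAt_iff_tendsto_slope.1 h).mono_left
      (nhdsWithin_mono 0 (fun t (ht : 0 < t) => ht.ne'))).congr fun t => ?_
    simp [slope_def_field, div_eq_inv_mul]
  refine le_of_tendsto_of_tendsto
    (tendsto_slope_setIntegral_det μ hW (hf.continuous_fderiv one_ne_zero)) hpow ?_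
  have hlt : ∀ᶠ t : ℝ in nhdsWithin (0 : ℝ) (Ioi 0), t * K < 1 := by
    refine nhdsWithin_le_nhds (Filter.Tendsto.eventually_lt_const one_pos ?_)
    have : Continuous fun t : ℝ => t * K := by fun_prop
    simpa using this.tendsto 0
  filter_upwards [hlt, self_mem_nhdsWithin] with t ht ht0
  rw [mem_Ioi] at ht0
  refine mul_le_mul_of_nonneg_left (sub_le_sub_right ?_ _) (inv_nonneg.2 ht0.le)
  have hderiv (x : E) : HasFDerivAt (fun x => x + t • f x) (1 + t • fderiv ℝ f x) x :=
    (hasFDerivAt_id x).add (((hf.differentiable one_ne_zero) x).hasFDerivAt.const_smul t)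
  -- A perturbation of the identity with Lipschitz constant tK < 1 is injective.
  have hinj : InjOn (fun x => x + t • f x) W := by
    intro x _ y _ hxy
    by_contra hne
    have h1 : x - y = t • (f y - f x) := by
      rw [smul_sub]
      have : x + t • f x = y + t • f y := hxy
      rw [sub_eq_sub_iff_add_eq_add, this, add_comm]
    have h2 : ‖x - y‖ ≤ t * K * ‖x - y‖ := by
      conv_lhs => rw [h1, norm_smul, Real.norm_of_nonneg ht0.le]
      rw [mul_assoc, norm_sub_rev x y]
      exact mul_le_mul_of_nonneg_left (hK.norm_sub_le y x) ht0.le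
    have h3 : 0 < ‖x - y‖ := norm_pos_iff.2 (sub_ne_zero.2 hne)
    nlinarith
  have hsub : (fun x => x + t • f x) '' W ⊆ (1 + t) • W := by
    rintro _ ⟨x, hx, rfl⟩
    have h1 : 0 < 1 + t := by linarith
    rw [mem_smul_set_iff_inv_smul_mem₀ h1.ne']
    -- (x + t f(x))/(1+t) is a convex combination of x and f(x), both in W.
    have := hconv hx (hfW x) (a := (1 + t)⁻¹) (b := (1 + t)⁻¹ * t) (by positivity) (by positivity)
      (by field_simp)
    simpa [smul_add, mul_smul] using this
  have hcont : Continuous fun x => (1 + t • fderiv ℝ f x).det :=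
    ContinuousLinearMap.continuous_det.comp
      (continuous_const.add ((hf.continuous_fderiv one_ne_zero).const_smul t))
  have harea := lintegral_abs_det_fderiv_eq_addHaar_image μ hW.measurableSet
    (fun x _ => (hderiv x).hasFDerivWithinAt) hinj
  calc ∫ x in W, (1 + t • fderiv ℝ f x).det ∂μ
      ≤ ∫ x in W, |(1 + t • fderiv ℝ f x).det| ∂μ :=
        integral_mono (hcont.continuousOn.integrableOn_compact hW)
          (hcont.abs.continuousOn.integrableOn_compact hW) fun x => le_abs_self _
    _ = μ.real ((fun x => x + t • f x) '' W) := by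
        rw [integral_eq_lintegral_of_nonneg_ae (.of_forall fun x => abs_nonneg _)
          hcont.abs.aestronglyMeasurable, harea, Measure.real]
    _ ≤ μ.real ((1 + t) • W) := measureReal_mono hsub (hW.smul _).measure_ne_top
    _ = (1 + t) ^ d * μ.real W := by
        rw [Measure.real, Measure.addHaar_smul, ENNReal.toReal_mul,
          ENNReal.toReal_ofReal (abs_nonneg _), abs_of_nonneg (by positivity), Measure.real]

end Det

/-- Multiplication on ℝ is commutative, so the pairing equals its flip. -/
theorem integral_lsmul_toSignedMeasure {X : Type*} [MeasurableSpace X] (m : Measure X) [IsFiniteMeasure m] (f : X → ℝ) :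
    ∫ᵛ x, f x ∂•m.toSignedMeasure = ∫ x, f x ∂m := by
  have h : ContinuousLinearMap.lsmul ℝ ℝ (E := ℝ) = (ContinuousLinearMap.lsmul ℝ ℝ).flip := by
    ext
    simp
  rw [h]
  exact VectorMeasure.integral_toSignedMeasure

/-! ### Directional derivatives of the indicator of a compact convex set. -/

section DirectionalTrace

variable {E : Type*} [NormedAddCommGroup E] [NormedSpace ℝ E]

/-- The points that reach `W` by a translation by `s • e` with `s ∈ I`. -/
def shadow (W : Set E) (e : E) (I : Set ℝ) : Set E := {x | ∃ s ∈ I, x + s • e ∈ W}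

/-- The times in `[0, 1]` which the trajectory of `x` with velocity `e` spends in `W`. -/
def hitTimes (W : Set E) (e x : E) : Set ℝ := {s | s ∈ Icc (0 : ℝ) 1 ∧ x + s • e ∈ W}

variable {W : Set E} {e x : E}

theorem isCompact_hitGraph (hW : IsCompact W) {I : Set ℝ} (hI : IsCompact I) :
    IsCompact {p : E × ℝ | p.2 ∈ I ∧ p.1 + p.2 • e ∈ W} := by
  -- The set is the image of W × I under this shear.
  have h : Continuous fun p : E × ℝ => (p.1 - p.2 • e, p.2) := by fun_prop
  convert (hW.prod hI).image h using 1
  ext ⟨x, s⟩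
  simp only [mem_ofPred_eq, mem_image, mem_prod, Prod.mk.injEq, Prod.exists]
  constructor
  · rintro ⟨hs, hx⟩
    exact ⟨_, s, ⟨hx, hs⟩, by simp, rfl⟩
  · rintro ⟨y, s, ⟨hy, hs⟩, rfl, rfl⟩
    exact ⟨hs, by simpa using hy⟩

theorem isCompact_shadow (hW : IsCompact W) {I : Set ℝ} (hI : IsCompact I) :
    IsCompact (shadow W e I) := by
  convert (isCompact_hitGraph (e := e) hW hI).image continuous_fst using 1
  ext x
  simp [shadow]

theorem isCompact_hitTimes (hW : IsClosed W) : IsCompact (hitTimes W e x) :=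
  isCompact_Icc.inter_right (hW.preimage (f := fun s : ℝ => x + s • e) (by fun_prop))

theorem convex_hitTimes (hW : Convex ℝ W) : Convex ℝ (hitTimes W e x) := by
  refine (convex_Icc 0 1).inter fun s hs t ht a b ha hb hab => ?_
  have : a • (x + s • e) + b • (x + t • e) ∈ W := hW hs ht ha hb hab
  change x + (a • s + b • t) • e ∈ W
  convert this using 1
  have hx : x = a • x + b • x := by rw [← add_smul, hab, one_smul]
  nth_rw 1 [hx]
  simp only [smul_eq_mul, smul_add, add_smul, mul_smul]
  abel

theorem hitTimes_subset : hitTimes W e x ⊆ Icc 0 1 := fun _ h => h.1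

theorem hitTimes_nonempty_iff : (hitTimes W e x).Nonempty ↔ x ∈ shadow W e (Icc 0 1) := Iff.rfl

theorem hitTimes_eq_Icc (hW : IsCompact W) (hconv : Convex ℝ W)
    (hx : x ∈ shadow W e (Icc 0 1)) :
    hitTimes W e x = Icc (sInf (hitTimes W e x)) (sSup (hitTimes W e x)) :=
  eq_Icc_of_connected_compact ⟨hx, (convex_hitTimes hconv).isPreconnected⟩
    (isCompact_hitTimes hW.isClosed)

theorem integral_hitTimes_fderiv (hW : IsCompact W) (hconv : Convex ℝ W) {f : E → ℝ}
    (hf : ContDiff ℝ 1 f) (hx : x ∈ shadow W e (Icc 0 1)) :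
    ∫ s in hitTimes W e x, fderiv ℝ f (x + s • e) e =
      f (x + sSup (hitTimes W e x) • e) - f (x + sInf (hitTimes W e x) • e) := by
  have hle : sInf (hitTimes W e x) ≤ sSup (hitTimes W e x) :=
    csInf_le_csSup hx (bddBelow_Icc.mono hitTimes_subset)
      (bddAbove_Icc.mono hitTimes_subset)
  rw [setIntegral_congr_set (hitTimes_eq_Icc hW hconv hx).eventuallyEq,
    integral_Icc_eq_integral_Ioc, ← intervalIntegral.integral_of_le hle]
  refine intervalIntegral.integral_eq_sub_of_hasDerivAt (f := fun s : ℝ => f (x + s • e))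
    (fun s _ => ?_) (Continuous.intervalIntegrable ?_ _ _)
  · have h1 : HasDerivAt (fun s : ℝ => x + s • e) e s := by
      simpa using ((hasDerivAt_id s).smul_const e).const_add x
    exact ((hf.differentiable one_ne_zero) (x + s • e)).hasFDerivAt.comp_hasDerivAt s h1
  · exact ((hf.continuous_fderiv one_ne_zero).comp (by fun_prop)).clm_apply continuous_const

variable [MeasurableSpace E] [BorelSpace E]

theorem measurable_sSup_hitTimes (hW : IsCompact W) (e : E) :
    Measurable fun x => sSup (hitTimes W e x) := by
  refine measurable_of_Ici fun t => ?_
  rcases le_or_gt t 0 with ht | ht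
  · convert MeasurableSet.univ
    refine eq_univ_of_forall fun x => ht.trans (Real.sSup_nonneg fun s hs => hs.1.1)
  -- For t > 0 the last hitting time is at least t exactly when W is hit during [t, 1].
  · convert (isCompact_shadow (e := e) hW (isCompact_Icc (a := t) (b := 1))).measurableSet using 1
    ext x
    constructor
    · intro (h : t ≤ sSup (hitTimes W e x))
      rcases (hitTimes W e x).eq_empty_or_nonempty with h0 | h0
      · rw [h0, Real.sSup_empty] at h
        linarith
      · have := (isCompact_hitTimes hW.isClosed).sSup_mem h0
        exact ⟨_, ⟨h, this.1.2⟩, this.2⟩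
    · rintro ⟨s, hs, hx⟩
      exact hs.1.trans (le_csSup (bddAbove_Icc.mono hitTimes_subset)
        ⟨⟨ht.le.trans hs.1, hs.2⟩, hx⟩)

theorem measurable_sInf_hitTimes (hW : IsCompact W) (e : E) :
    Measurable fun x => sInf (hitTimes W e x) := by
  refine measurable_of_Iic fun t => ?_
  rcases lt_or_ge t 0 with ht | ht
  · convert MeasurableSet.empty
    refine eq_empty_of_forall_notMem fun x (hx : sInf (hitTimes W e x) ≤ t) => ?_
    have : 0 ≤ sInf (hitTimes W e x) := Real.sInf_nonneg fun s hs => hs.1.1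
    linarith
  -- Points that never hit W count here, since `sInf ∅ = 0 ≤ t`.
  · convert (isCompact_shadow (e := e) hW (isCompact_Icc (a := 0) (b := 1))).measurableSet.compl.union
      (isCompact_shadow (e := e) hW (isCompact_Icc (a := 0) (b := min t 1))).measurableSet using 1
    ext x
    constructor
    · intro (h : sInf (hitTimes W e x) ≤ t)
      by_cases h0 : x ∈ shadow W e (Icc 0 1)
      · have := (isCompact_hitTimes hW.isClosed).sInf_mem h0
        exact Or.inr ⟨_, ⟨this.1.1, le_min h this.1.2⟩, this.2⟩
      · exact Or.inl h0
    · rintro (h0 | ⟨s, hs, hx⟩)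
      · rw [mem_compl_iff, ← hitTimes_nonempty_iff, not_nonempty_iff_eq_empty] at h0
        rw [mem_preimage, h0, Real.sInf_empty]
        exact ht
      · exact (csInf_le (bddBelow_Icc.mono hitTimes_subset)
          ⟨⟨hs.1, hs.2.trans (min_le_right _ _)⟩, hx⟩).trans (hs.2.trans (min_le_left _ _))

variable [FiniteDimensional ℝ E] (μ : Measure E) [μ.IsAddHaarMeasure]

/-- Fubini in the directions transversal to `e`, averaged over translations by `s • e`. -/
theorem setIntegral_fderiv_eq (hW : IsCompact W) (hconv : Convex ℝ W) (e : E) {f : E → ℝ}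
    (hf : ContDiff ℝ 1 f) :
    ∫ x in W, fderiv ℝ f x e ∂μ = ∫ x in shadow W e (Icc 0 1),
      (f (x + sSup (hitTimes W e x) • e) - f (x + sInf (hitTimes W e x) • e)) ∂μ := by
  -- Integrate over T in both orders. For fixed s, translation invariance gives the left side; for
  -- fixed x, the fundamental theorem of calculus on the hitting interval gives the right side.
  set T : Set (E × ℝ) := {p | p.2 ∈ Icc (0 : ℝ) 1 ∧ p.1 + p.2 • e ∈ W}
  set g : E → ℝ := fun x => fderiv ℝ f x e
  have hg : Continuous g := (hf.continuous_fderiv one_ne_zero).clm_apply continuous_const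
  have hT : IsCompact T := isCompact_hitGraph hW isCompact_Icc
  have hint : Integrable (T.indicator fun p => g (p.1 + p.2 • e)) (μ.prod volume) :=
    (integrable_indicator_iff hT.measurableSet).2
      ((hg.comp (by fun_prop)).continuousOn.integrableOn_compact hT)
  have h1 (s : ℝ) : ∫ x, T.indicator (fun p => g (p.1 + p.2 • e)) (x, s) ∂μ =
      (Icc (0 : ℝ) 1).indicator (fun _ => ∫ x in W, g x ∂μ) s := by
    by_cases hs : s ∈ Icc (0 : ℝ) 1
    · rw [indicator_of_mem hs, ← integral_indicator hW.measurableSet]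
      refine Eq.trans ?_ (integral_add_right_eq_self _ (s • e))
      refine integral_congr_ae (.of_forall fun x => ?_)
      have h : (x, s) ∈ T ↔ x + s • e ∈ W := and_iff_right hs
      by_cases hx : x + s • e ∈ W
      · simp [indicator, hx, h]
      · simp [indicator, hx, h]
    · rw [indicator_of_notMem hs]
      refine integral_eq_zero_of_ae (.of_forall fun x => ?_)
      exact indicator_of_notMem (fun h => hs h.1) _
  have h2 (x : E) : ∫ s, T.indicator (fun p => g (p.1 + p.2 • e)) (x, s) =
      (shadow W e (Icc 0 1)).indicator
        (fun x => f (x + sSup (hitTimes W e x) • e) - f (x + sInf (hitTimes W e x) • e)) x := by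
    have h3 : ∫ s, T.indicator (fun p => g (p.1 + p.2 • e)) (x, s) =
        ∫ s in hitTimes W e x, g (x + s • e) := by
      rw [← integral_indicator (isCompact_hitTimes hW.isClosed).measurableSet]
      rfl
    by_cases hx : x ∈ shadow W e (Icc 0 1)
    · rw [h3, indicator_of_mem hx, integral_hitTimes_fderiv hW hconv hf hx]
    · rw [h3, indicator_of_notMem hx,
        not_nonempty_iff_eq_empty.1 (hitTimes_nonempty_iff.not.2 hx), setIntegral_empty]
  rw [← integral_indicator (isCompact_shadow hW isCompact_Icc).measurableSet,
    ← integral_congr_ae (.of_forall h2), ← integral_prod _ hint, integral_prod_symm _ hint,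
    integral_congr_ae (.of_forall h1), integral_indicator measurableSet_Icc]
  simp

theorem exists_signedMeasure_setIntegral_fderiv (hW : IsCompact W) (hconv : Convex ℝ W) (e : E) :
    ∃ ν : SignedMeasure E, ∀ f : E → ℝ, ContDiff ℝ 1 f → HasCompactSupport f →
      ∫ x in W, fderiv ℝ f x e ∂μ = -∫ᵛ x, f x ∂•ν := by
  set A := shadow W e (Icc 0 1)
  have hA : IsCompact A := isCompact_shadow hW isCompact_Icc
  have hfin : IsFiniteMeasure (μ.restrict A) := ⟨by simpa using hA.measure_lt_top⟩
  have hb : Measurable fun x => x + sSup (hitTimes W e x) • e :=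
    measurable_id.add ((measurable_sSup_hitTimes hW e).smul_const e)
  have ha : Measurable fun x => x + sInf (hitTimes W e x) • e :=
    measurable_id.add ((measurable_sInf_hitTimes hW e).smul_const e)
  set μa := (μ.restrict A).map fun x => x + sInf (hitTimes W e x) • e
  set μb := (μ.restrict A).map fun x => x + sSup (hitTimes W e x) • e
  -- Entry measure minus exit measure: the minus sign in the distributional gradient reverses the
  -- order.
  refine ⟨μa.toSignedMeasure - μb.toSignedMeasure, fun f hf hsupp => ?_⟩
  have hint (m : Measure E) [IsFiniteMeasure m] : Integrable f m :=
    hf.continuous.integrable_of_hasCompactSupport hsupp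
  have hint' (m : Measure E) [IsFiniteMeasure m] : m.toSignedMeasure.Integrable f := by
    rw [VectorMeasure.Integrable, Measure.variation_toSignedMeasure]
    exact hint m
  rw [VectorMeasure.integral_sub_vectorMeasure (hint' _) (hint' _),
    integral_lsmul_toSignedMeasure, integral_lsmul_toSignedMeasure,
    setIntegral_fderiv_eq μ hW hconv e hf, integral_sub, integral_map ha.aemeasurable,
    integral_map hb.aemeasurable, neg_sub]
  · exact hf.continuous.aestronglyMeasurable
  · exact hf.continuous.aestronglyMeasurable
  · exact (hint μb).comp_measurable hb
  · exact (hint μa).comp_measurable ha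

end DirectionalTrace

/-! ### The divergence formula, the extremal fields and the conclusion. -/

section Perimeter

theorem EuclideanSpace.trace_eq_sum {n : ℕ}
    (A : EuclideanSpace ℝ (Fin n) →ₗ[ℝ] EuclideanSpace ℝ (Fin n)) :
    LinearMap.trace ℝ _ A = ∑ i, A (EuclideanSpace.single i 1) i := by
  rw [LinearMap.trace_eq_sum_inner A (EuclideanSpace.basisFun (Fin n) ℝ)]
  simp [EuclideanSpace.inner_single_left]

theorem integral_indicator_one_mul {X : Type*} [MeasurableSpace X] {m : Measure X} {W : Set X}
    (hW : MeasurableSet W) (g : X → ℝ) :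
    ∫ x, W.indicator (fun _ => (1 : ℝ)) x * g x ∂m = ∫ x in W, g x ∂m := by
  rw [← integral_indicator hW]
  congr 1
  ext x
  by_cases hx : x ∈ W <;> simp [hx]

variable {n : ℕ} {φ : EuclideanSpace ℝ (Fin n) → ℝ}

theorem IsAnisotropy.exists_isDistribGradient (hφ : IsAnisotropy φ) :
    ∃ μ, IsDistribGradient ((wulffShape φ).indicator fun _ => (1 : ℝ)) μ := by
  choose μ hμ using fun i : Fin n => exists_signedMeasure_setIntegral_fderiv volume
    hφ.isCompact_wulffShape (convex_wulffShape φ) (EuclideanSpace.single i (1 : ℝ))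
  refine ⟨μ, fun f hf hsupp i => ?_⟩
  rw [integral_indicator_one_mul hφ.isCompact_wulffShape.measurableSet]
  exact hμ i f hf hsupp

theorem IsDistribGradient.integralAgainst_neg {W : Set (EuclideanSpace ℝ (Fin n))}
    (hW : IsCompact W) {μ : Fin n → SignedMeasure (EuclideanSpace ℝ (Fin n))}
    (hμ : IsDistribGradient (W.indicator fun _ => (1 : ℝ)) μ)
    {ζ : EuclideanSpace ℝ (Fin n) → EuclideanSpace ℝ (Fin n)}
    (hζ : ContDiff ℝ 1 ζ) (hsupp : HasCompactSupport ζ) :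
    integralAgainst μ (fun x => -ζ x) = ∫ x in W, LinearMap.trace ℝ _ (fderiv ℝ ζ x).toLinearMap := by
  have hd (i : Fin n) (x) : fderiv ℝ (fun x => (-ζ x) i) x (EuclideanSpace.single i 1) =
      -(fderiv ℝ ζ x (EuclideanSpace.single i 1) i) := by
    have h := ((EuclideanSpace.proj i : EuclideanSpace ℝ (Fin n) →L[ℝ] ℝ).hasFDerivAt.comp x
      (hζ.differentiable one_ne_zero x).hasFDerivAt).neg
    rw [show (fun x => (-ζ x) i) = -(⇑(EuclideanSpace.proj i : EuclideanSpace ℝ (Fin n) →L[ℝ] ℝ) ∘ ζ)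
      from rfl, h.fderiv]
    rfl
  have hcont (i : Fin n) : Continuous fun x => fderiv ℝ ζ x (EuclideanSpace.single i 1) i :=
    (EuclideanSpace.proj i : EuclideanSpace ℝ (Fin n) →L[ℝ] ℝ).continuous.comp
      ((hζ.continuous_fderiv one_ne_zero).clm_apply continuous_const)
  simp only [EuclideanSpace.trace_eq_sum]
  rw [integralAgainst, integral_finsetSum _ fun i _ => by
    exact (hcont i).continuousOn.integrableOn_compact hW]
  refine Finset.sum_congr rfl fun i _ => ?_
  obtain ⟨h1, h2⟩ := coord_contDiff_hasCompactSupport hζ.neg hsupp.neg i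
  have h := hμ _ h1 h2 i
  rw [integral_indicator_one_mul hW.measurableSet] at h
  have h3 := neg_eq_iff_eq_neg.2 h
  rw [← integral_neg] at h3
  refine h3.symm.trans ?_
  congr 1
  ext x
  exact neg_eq_iff_eq_neg.2 (hd i x)

/-- A cutoff of the field `x ↦ a • x`. -/
theorem exists_field_trace_fderiv_eq {E : Type*} [NormedAddCommGroup E] [NormedSpace ℝ E]
    [FiniteDimensional ℝ E] {W : Set E} (hW : IsCompact W) (hconv : Convex ℝ W)
    (h0 : W ∈ nhds 0) {a : ℝ} (ha0 : 0 < a) (ha1 : a < 1) :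
    ∃ ζ : E → E, ContDiff ℝ 1 ζ ∧ HasCompactSupport ζ ∧ (∀ x, ζ x ∈ W) ∧
      ∀ x ∈ W, LinearMap.trace ℝ E (fderiv ℝ ζ x).toLinearMap = a * Module.finrank ℝ E := by
  have h0W : (0 : E) ∈ W := mem_of_mem_nhds h0
  set U : Set E := {x | a • x ∈ interior W}
  -- Since a < 1 and 0 is interior to W, the open set U contains W, which leaves room for a cutoff η
  -- equal to 1 on W.
  have hU : IsOpen U := isOpen_interior.preimage (f := fun x => a • x) (by fun_prop)
  have hWU : W ⊆ U := fun x hx => by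
    have := hconv.combo_interior_self_mem_interior (mem_interior_iff_mem_nhds.2 h0) hx
      (a := 1 - a) (b := a) (by linarith) ha0.le (by ring)
    change a • x ∈ interior W
    simpa using this
  obtain ⟨η, hη, hrange, hsupp, hone⟩ := exists_contMDiff_support_eq_eq_one_iff
    (modelWithCornersSelf ℝ E) (n := 1) hU hW.isClosed hWU
  have hη' : ContDiff ℝ 1 η := contMDiff_iff_contDiff.1 hη
  have hη01 (x : E) : η x ∈ Icc (0 : ℝ) 1 := hrange ⟨x, rfl⟩
  refine ⟨fun x => η x • a • x, hη'.smul (contDiff_const.smul contDiff_id), ?_, fun x => ?_,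
    fun x hx => ?_⟩
  · refine HasCompactSupport.intro ((hW.image (continuous_const_smul a⁻¹))) fun x hx => ?_
    have : x ∉ Function.support η := fun h => by
      rw [hsupp] at h
      exact hx ⟨a • x, interior_subset h, inv_smul_smul₀ ha0.ne' x⟩
    simp [Function.notMem_support.1 this]
  · by_cases hx : x ∈ Function.support η
    · rw [hsupp] at hx
      exact hconv.smul_mem_of_zero_mem h0W (interior_subset hx) (hη01 x)
    · simpa [Function.notMem_support.1 hx] using h0W
  · have h1 : η x = 1 := (hone x).1 hx
    -- η attains its maximum 1 at every point of W, so its derivative vanishes there, boundary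
    -- points included.
    have hmax : fderiv ℝ η x = 0 :=
      IsLocalMax.fderiv_eq_zero (Filter.Eventually.of_forall fun y => by
        rw [h1]; exact (hη01 y).2)
    have hd := (hη'.differentiable one_ne_zero x).hasFDerivAt.smul
      ((hasFDerivAt_id (𝕜 := ℝ) x).const_smul a)
    have hd' : fderiv ℝ (fun x => η x • a • x) x = a • ContinuousLinearMap.id ℝ E := by
      refine hd.fderiv.trans ?_
      rw [hmax, h1]
      ext
      simp
    rw [hd']
    simp

end Perimeter

theorem mainTheorem6 {n : ℕ} (φ : EuclideanSpace ℝ (Fin n) → ℝ) (hφ : IsAnisotropy φ) :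
    MemBV ((wulffShape φ).indicator fun _ => (1 : ℝ)) ∧
      anisoPerimeter φ (wulffShape φ) =
        (((n : ℝ≥0∞) * volume (wulffShape φ) : ℝ≥0∞) : EReal) := by
  have hW := hφ.isCompact_wulffShape
  have hconv := convex_wulffShape φ
  have hint : Integrable ((wulffShape φ).indicator fun _ => (1 : ℝ)) :=
    (integrable_indicator_iff hW.measurableSet).2 (integrableOn_const hW.measure_ne_top)
  obtain ⟨μ, hμ⟩ := hφ.exists_isDistribGradient
  refine ⟨⟨hint, μ, hμ⟩, ?_⟩
  set v : ℝ := n * volume.real (wulffShape φ)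
  have hv : (((n : ℝ≥0∞) * volume (wulffShape φ) : ℝ≥0∞) : EReal) = (v : EReal) := by
    obtain ⟨w, hw⟩ := WithTop.ne_top_iff_exists.1 (hW.measure_ne_top (μ := volume))
    replace hw : (w : ℝ≥0∞) = volume (wulffShape φ) := hw
    simp only [v, Measure.real, ← hw]
    norm_cast
  rw [hv, anisoPerimeter, anisoTV_eq φ hint hμ, anisoVariation]
  refine le_antisymm (sSup_le ?_) ?_
  · rintro _ ⟨ψ, h1, h2, h3, rfl⟩
    have h := hμ.integralAgainst_neg hW h1.neg h2.neg
    have h4 := setIntegral_trace_fderiv_le volume hW hconv h1.neg h2.neg h3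
    simp only [neg_neg] at h
    rw [EReal.coe_le_coe_iff, h]
    simpa using h4
  · have hlim : Filter.Tendsto (fun a : ℝ => ((a * v : ℝ) : EReal)) (nhdsWithin 1 (Iio 1))
        (nhds (v : EReal)) := by
      have : Continuous fun a : ℝ => ((a * v : ℝ) : EReal) :=
        continuous_coe_real_ereal.comp (by fun_prop)
      simpa using (this.tendsto 1).mono_left nhdsWithin_le_nhds
    refine le_of_tendsto hlim ?_
    filter_upwards [Ioo_mem_nhdsLT (zero_lt_one (α := ℝ))] with a ha
    obtain ⟨ζ, h1, h2, h3, h4⟩ :=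
      exists_field_trace_fderiv_eq hW hconv hφ.wulffShape_mem_nhds ha.1 ha.2
    refine le_sSup ⟨fun x => -ζ x, h1.neg, h2.neg, fun x => by simpa using h3 x, ?_⟩
    rw [hμ.integralAgainst_neg hW h1 h2, setIntegral_congr_fun hW.measurableSet h4]
    rw [EReal.coe_eq_coe_iff, setIntegral_const, finrank_euclideanSpace_fin, smul_eq_mul]
    ring
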